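/- Let $\mathcal H$ be a complex Hilbert space, let $H_0$ be a self-adjoint operator in $\mathcal H$ with domain $D(H_0)$, and let $B$ be a linear operator in $\mathcal H$ with $D(H_0)\subseteq D(B)$ such that $H=H_0+B$ is self-adjoint on $D(H_0)$. For a self-adjoint operator $S$ put $\mathcal D^\infty(S)=\bigcap_{n\ge 1}D(S^n)$, and assume that $\mathcal D^\infty(H_0)=\mathcal D^\infty(H)=:\mathcal D$. For $S\in\{H_0,H\}$ let $t_S$ be the topology on $\mathcal D$ defined by the seminorms $\varphi\mapsto\|S^n\varphi\|$, $n=0,1,2,\dots$. Let $\mathcal L^\dagger(\mathcal D)$ be the space of all weakly continuous endomorphisms of $\mathcal D$, i.e. of the linear maps $A:\mathcal D\to\mathcal D$ that are continuous for the weak topology $\sigma(\mathcal D,\mathcal D)$ given by the inner product (equivalently, there is a linear map $A^\dagger:\mathcal D\to\mathcal D$ with $\langle A^\dagger\psi,\varphi\rangle=\langle\psi,A\varphi\rangle$ for all $\varphi,\psi\in\mathcal D$). Let $\mathcal F$ be the class of all positive, bounded, continuous functions $f:\mathbb R\to\mathbb R$ with $\sup_{x}|x|^kf(x)<\infty$ for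 $k=0,1,2,\dots$ (if $S\ge 0$, only the restriction of $f$ to $[0,\infty)$ matters for $f(S)$). Then: (1) the topologies $t_{H_0}$ and $t_H$ on $\mathcal D$ coincide; (2) the topologies on $\mathcal L^\dagger(\mathcal D)$ defined by the families of seminorms $$A\mapsto\max\{\|H_0^kAf(H_0)\|,\ \|f(H_0)AH_0^k\|\},\qquad f\in\mathcal F,\ k=0,1,2,\dots,$$ and $$A\mapsto\max\{\|H^kAf(H)\|,\ \|f(H)AH^k\|\},\qquad f\in\mathcal F,\ k=0,1,2,\dots,$$ coincide. Here $f(S)$ is given by the functional calculus of $S$, and the norms are the operator norms of the (closures of the) bounded operators concerned. -/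

import Mathlib

open scoped InnerProductSpace
open Filter Topology

noncomputable section

namespace QuasiUniform

variable {H : Type*} [NormedAddCommGroup H] [InnerProductSpace ℂ H]

/-- The composition `g ∘ f` of two operators, on the natural domain
`{x ∈ D(f) | f x ∈ D(g)}`. -/
def pcomp (g f : H →ₗ.[ℂ] H) : H →ₗ.[ℂ] H where
  domain := (g.domain.comap f.toFun).map f.domain.subtype
  toFun := g.toFun.comp (LinearMap.codRestrict g.domain
    (f.toFun.comp (Submodule.inclusion (Submodule.map_subtype_le f.domain _)))
    (by rintro ⟨_, ⟨y, hy, rfl⟩⟩; exact hy))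

theorem mem_pcomp_domain {g f : H →ₗ.[ℂ] H} {x : H} :
    x ∈ (pcomp g f).domain ↔ ∃ h : x ∈ f.domain, f ⟨x, h⟩ ∈ g.domain := by
  constructor
  · rintro ⟨y, hy, rfl⟩
    exact ⟨y.2, hy⟩
  · rintro ⟨h, h'⟩
    exact ⟨⟨x, h⟩, h', rfl⟩

/-- The powers `S⁰ = 1` (on the whole space), `Sⁿ⁺¹ = Sⁿ S` on
`D(Sⁿ⁺¹) = {x ∈ D(S) | S x ∈ D(Sⁿ)}`. -/
def opPow (S : H →ₗ.[ℂ] H) : ℕ → (H →ₗ.[ℂ] H)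
  | 0 => (LinearMap.id : H →ₗ[ℂ] H).toPMap ⊤
  | n + 1 => pcomp (opPow S n) S

/-- The space `D^∞(S) = ⋂ₙ D(Sⁿ)` of smooth vectors of `S`. -/
def smoothDomain (S : H →ₗ.[ℂ] H) : Submodule ℂ H :=
  ⨅ n : ℕ, (opPow S n).domain

theorem mem_smoothDomain {S : H →ₗ.[ℂ] H} {x : H} :
    x ∈ smoothDomain S ↔ ∀ n, x ∈ (opPow S n).domain := by
  simp [smoothDomain]

theorem smoothDomain_le (S : H →ₗ.[ℂ] H) : smoothDomain S ≤ S.domain := fun _ hx =>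
  (mem_pcomp_domain.1 (mem_smoothDomain.1 hx 1)).1

theorem apply_mem_smoothDomain {S : H →ₗ.[ℂ] H} {x : H} (hx : x ∈ smoothDomain S) :
    S ⟨x, smoothDomain_le S hx⟩ ∈ smoothDomain S :=
  mem_smoothDomain.2 fun n => (mem_pcomp_domain.1 (mem_smoothDomain.1 hx (n + 1))).2

/-- The restriction of `S` to `D = D^∞(S)`, as an endomorphism of `D`. -/
def restr (S : H →ₗ.[ℂ] H) {D : Submodule ℂ H} (hD : D = smoothDomain S) :
    Module.End ℂ D :=
  LinearMap.codRestrict D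
    (S.toFun.comp (Submodule.inclusion (hD.le.trans (smoothDomain_le S))))
    (fun x => hD.symm ▸ apply_mem_smoothDomain (hD.le x.2))

theorem coe_restr_apply (S : H →ₗ.[ℂ] H) {D : Submodule ℂ H} (hD : D = smoothDomain S) (x : D) :
    (restr S hD x : H) = S ⟨x, smoothDomain_le S (hD.le x.2)⟩ := rfl

/-- The powers of the restriction are the restrictions of the powers. -/
theorem coe_restr_pow_apply (S : H →ₗ.[ℂ] H) {D : Submodule ℂ H} (hD : D = smoothDomain S)
    (n : ℕ) (x : D) :
    ((restr S hD ^ n) x : H) = opPow S n ⟨x, mem_smoothDomain.1 (hD.le x.2) n⟩ := by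
  induction n generalizing x with
  | zero => rfl
  | succ n ih => rw [pow_succ, Module.End.mul_apply, ih]; rfl

/-- The topology defined by a family of seminorms. -/
abbrev seminormTopology {E ι : Type*} [AddCommGroup E] [Module ℂ E] (p : ι → Seminorm ℂ E) :
    TopologicalSpace E :=
  ⨅ i, (p i).toSeminormedAddCommGroup.toUniformSpace.toTopologicalSpace

/-- The seminorm `φ ↦ ‖Sⁿ φ‖` on `D = D^∞(S)`. -/
def graphSeminorm (S : H →ₗ.[ℂ] H) {D : Submodule ℂ H} (hD : D = smoothDomain S) (n : ℕ) :
    Seminorm ℂ D :=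
  (normSeminorm ℂ H).comp (D.subtype ∘ₗ (restr S hD ^ n))

/-- The topology `t_S` on `D = D^∞(S)`, defined by the seminorms `φ ↦ ‖Sⁿ φ‖`, `n ≥ 0`. -/
abbrev graphTopology (S : H →ₗ.[ℂ] H) {D : Submodule ℂ H} (hD : D = smoothDomain S) :
    TopologicalSpace D :=
  seminormTopology (graphSeminorm S hD)

/-- The weak topology `σ(D, D)`: the coarsest one for which all the functionals
`φ ↦ ⟨ψ, φ⟩`, `ψ ∈ D`, are continuous. -/
abbrev weakTopology (D : Submodule ℂ H) : TopologicalSpace D :=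
  ⨅ ψ : D, TopologicalSpace.induced (fun φ : D => ⟪(ψ : H), (φ : H)⟫_ℂ) inferInstance

theorem continuous_weak_iff {D : Submodule ℂ H} {A : Module.End ℂ D} :
    Continuous[weakTopology D, weakTopology D] A ↔
      ∀ ψ : D, Continuous[weakTopology D, _] fun φ : D => ⟪(ψ : H), (A φ : H)⟫_ℂ := by
  rw [weakTopology, continuous_iInf_rng]
  simp_rw [continuous_induced_rng]
  rfl

/-- Weakly continuous endomorphisms are those that have an adjoint leaving `D` invariant. -/
theorem continuous_weak_iff_exists {D : Submodule ℂ H} {A : Module.End ℂ D} :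
    Continuous[weakTopology D, weakTopology D] A ↔
      ∃ B : Module.End ℂ D, ∀ ψ φ : D, ⟪(B ψ : H), (φ : H)⟫_ℂ = ⟪(ψ : H), (A φ : H)⟫_ℂ := by
  rw [continuous_weak_iff]
  have key : ∀ l : D →ₗ[ℂ] ℂ, Continuous[weakTopology D, _] l ↔
      ∃ χ : D, ∀ φ : D, ⟪(χ : H), (φ : H)⟫_ℂ = l φ := by
    intro l
    have h := LinearMap.mem_span_iff_continuous
      (f := fun ψ : D => ((innerₛₗ ℂ (ψ : H)).comp D.subtype : D →ₗ[ℂ] ℂ)) l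
    rw [show weakTopology D = ⨅ ψ : D, TopologicalSpace.induced
      ((innerₛₗ ℂ (ψ : H)).comp D.subtype : D →ₗ[ℂ] ℂ) inferInstance from rfl, ← h]
    constructor
    · intro hl
      clear h
      induction hl using Submodule.span_induction with
      | mem x hx => obtain ⟨ψ, rfl⟩ := hx; exact ⟨ψ, fun φ => rfl⟩
      | zero => exact ⟨0, fun φ => by simp⟩
      | add x y _ _ hx hy =>
        obtain ⟨a, ha⟩ := hx
        obtain ⟨b, hb⟩ := hy
        exact ⟨a + b, fun φ => by simp [ha, hb]⟩
      | smul c x _ hx =>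
        obtain ⟨a, ha⟩ := hx
        exact ⟨(starRingEnd ℂ c) • a, fun φ => by simp [ha, mul_comm]⟩
    · rintro ⟨χ, hχ⟩
      exact Submodule.subset_span ⟨χ, LinearMap.ext hχ⟩
  constructor
  · intro h
    have h' : ∀ ψ : D, ∃ χ : D, ∀ φ : D, ⟪(χ : H), (φ : H)⟫_ℂ = ⟪(ψ : H), (A φ : H)⟫_ℂ :=
      fun ψ => (key ((innerₛₗ ℂ (ψ : H)).comp (D.subtype ∘ₗ A))).1 (h ψ)
    choose B hB using h'
    have ext' : ∀ a b : D, (∀ φ : D, ⟪(a : H), (φ : H)⟫_ℂ = ⟪(b : H), (φ : H)⟫_ℂ) → a = b :=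
      fun a b hab => ext_inner_right ℂ hab
    exact ⟨⟨⟨B, fun a b => ext' _ _ fun φ => by simp [hB]⟩,
      fun c a => ext' _ _ fun φ => by simp [hB]⟩, hB⟩
  · rintro ⟨B, hB⟩ ψ
    exact (key ((innerₛₗ ℂ (ψ : H)).comp (D.subtype ∘ₗ A))).2 ⟨B ψ, hB ψ⟩

/-- The space `L†(D)` of all weakly continuous endomorphisms of `D`. -/
def LDagger (D : Submodule ℂ H) : Submodule ℂ (Module.End ℂ D) where
  carrier := {A | Continuous[weakTopology D, weakTopology D] A}
  zero_mem' := continuous_weak_iff_exists.2 ⟨0, fun ψ φ => by simp⟩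
  add_mem' {a b} ha hb := by
    obtain ⟨a', ha'⟩ := continuous_weak_iff_exists.1 ha
    obtain ⟨b', hb'⟩ := continuous_weak_iff_exists.1 hb
    exact continuous_weak_iff_exists.2 ⟨a' + b', fun ψ φ => by
      simp [ha', hb']⟩
  smul_mem' c a ha := by
    obtain ⟨a', ha'⟩ := continuous_weak_iff_exists.1 ha
    exact continuous_weak_iff_exists.2 ⟨(starRingEnd ℂ c) • a', fun ψ φ => by
      simp [ha', mul_comm]⟩

/-- `L†(D)` is closed under composition. -/
theorem mul_mem_LDagger {D : Submodule ℂ H} {A B : Module.End ℂ D} (hA : A ∈ LDagger D)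
    (hB : B ∈ LDagger D) : A * B ∈ LDagger D := by
  let _ := weakTopology D
  exact Continuous.comp (g := A) (f := B) hA hB

theorem pow_mem_LDagger {D : Submodule ℂ H} {A : Module.End ℂ D} (hA : A ∈ LDagger D) (k : ℕ) :
    A ^ k ∈ LDagger D := by
  induction k with
  | zero => exact continuous_weak_iff_exists.2 ⟨1, fun ψ φ => rfl⟩
  | succ k ih => rw [pow_succ]; exact mul_mem_LDagger ih hA

variable [CompleteSpace H]

section Resolvent

variable {S : H →ₗ.[ℂ] H}

theorem inner_symm_of_isSelfAdjoint (hS : IsSelfAdjoint S) (x y : S.domain) :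
    ⟪S x, (y : H)⟫_ℂ = ⟪(x : H), S y⟫_ℂ := by
  have h := LinearPMap.adjoint_isFormalAdjoint hS.dense_domain
  rw [LinearPMap.isSelfAdjoint_def.1 hS] at h
  exact h x y

theorem norm_le_norm_add_smul (hS : IsSelfAdjoint S) {c : ℂ} (hc : c = Complex.I ∨ c = -Complex.I)
    (x : S.domain) : ‖(x : H)‖ ≤ ‖S x + c • (x : H)‖ := by
  have h1 : ‖S x + c • (x : H)‖ ^ 2 = ‖S x‖ ^ 2 + ‖(x : H)‖ ^ 2 := by
    have him : (⟪S x, (x : H)⟫_ℂ).im = 0 := by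
      rw [← Complex.conj_eq_iff_im, inner_conj_symm, inner_symm_of_isSelfAdjoint hS]
    have hcn : ‖c‖ = 1 := by rcases hc with rfl | rfl <;> simp
    rw [norm_add_sq (𝕜 := ℂ), inner_smul_right, norm_smul, hcn]
    rcases hc with rfl | rfl <;> simp [him]
  nlinarith [norm_nonneg (x : H), norm_nonneg (S x + c • (x : H)), sq_nonneg ‖S x‖]

theorem exists_resolvent (hS : IsSelfAdjoint S) {c : ℂ} (hc : c = Complex.I ∨ c = -Complex.I) :
    ∃ R : H →L[ℂ] H, ∀ y : H, ∃ h : R y ∈ S.domain, S ⟨R y, h⟩ + c • R y = y := by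
  set T : S.domain →ₗ[ℂ] H := S.toFun + c • S.domain.subtype with hT
  have hTx : ∀ x : S.domain, T x = S x + c • (x : H) := fun x => rfl
  have hle : ∀ x : S.domain, ‖(x : H)‖ ≤ ‖T x‖ := norm_le_norm_add_smul hS hc
  have hinj : Function.Injective T := by
    rw [injective_iff_map_eq_zero]
    intro x hx
    have := hle x
    rw [hx, norm_zero] at this
    exact Subtype.ext (norm_le_zero_iff.1 this)
  have hclosed : IsClosed (LinearMap.range T : Set H) := by
    refine isClosed_of_closure_subset fun y hy => ?_
    obtain ⟨u, hu, huy⟩ := mem_closure_iff_seq_limit.1 hy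
    choose x hx using hu
    have hcau : CauchySeq fun n => (x n : H) := by
      have huc := huy.cauchySeq
      rw [Metric.cauchySeq_iff] at huc ⊢
      intro ε hε
      obtain ⟨N, hN⟩ := huc ε hε
      refine ⟨N, fun m hm n hn => lt_of_le_of_lt ?_ (hN m hm n hn)⟩
      rw [dist_eq_norm, dist_eq_norm, ← hx m, ← hx n, ← map_sub]
      exact hle (x m - x n)
    obtain ⟨a, ha⟩ := cauchySeq_tendsto_of_complete hcau
    have hSx : Tendsto (fun n => S (x n)) atTop (𝓝 (y - c • a)) := by
      have : (fun n => S (x n)) = fun n => u n - c • (x n : H) := by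
        funext n
        rw [← hx n, hTx, add_sub_cancel_right]
      rw [this]
      exact huy.sub (ha.const_smul c)
    have hg : (a, y - c • a) ∈ S.graph := by
      have hcl : IsClosed (S.graph : Set (H × H)) := hS.isClosed
      exact hcl.mem_of_tendsto (ha.prodMk_nhds hSx)
        (Eventually.of_forall fun n => S.mem_graph (x n))
    obtain ⟨b, hb1, hb2⟩ := (LinearPMap.mem_graph_iff _).1 hg
    refine ⟨b, ?_⟩
    rw [hTx, hb2, hb1]
    simp
  have hsurj : LinearMap.range T = ⊤ := by
    have : CompleteSpace (LinearMap.range T) := hclosed.completeSpace_coe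
    rw [← Submodule.orthogonal_eq_bot_iff, Submodule.eq_bot_iff]
    intro z hz
    have hz' : ∀ x : S.domain, ⟪(star (-c)) • z, (x : H)⟫_ℂ = ⟪z, S x⟫_ℂ := by
      intro x
      have h0 : ⟪z, S x + c • (x : H)⟫_ℂ = 0 :=
        (Submodule.mem_orthogonal' _ _).1 hz _ ⟨x, rfl⟩
      rw [inner_add_right, inner_smul_right] at h0
      rw [inner_smul_left]
      simp
      linear_combination -h0
    have hzd : z ∈ S.adjoint.domain := LinearPMap.mem_adjoint_domain_of_exists _ ⟨_, hz'⟩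
    have hzv : S.adjoint ⟨z, hzd⟩ = star (-c) • z :=
      LinearPMap.adjoint_apply_eq hS.dense_domain _ hz'
    have hg : (z, star (-c) • z) ∈ S.graph := by
      have : (z, star (-c) • z) ∈ S.adjoint.graph :=
        (LinearPMap.mem_graph_iff _).2 ⟨⟨z, hzd⟩, rfl, hzv⟩
      rwa [LinearPMap.isSelfAdjoint_def.1 hS] at this
    obtain ⟨b, hb1, hb2⟩ := (LinearPMap.mem_graph_iff _).1 hg
    have h2 := hle b
    have hsc : star (-c) = c := by rcases hc with rfl | rfl <;> simp
    have h3 := inner_symm_of_isSelfAdjoint hS b b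
    simp only at hb1 hb2
    rw [hb2, hb1, inner_smul_left, inner_smul_right, hsc] at h3
    have hcc : starRingEnd ℂ c = -c := by rcases hc with rfl | rfl <;> simp
    have hc0 : c ≠ 0 := by rcases hc with rfl | rfl <;> simp
    rw [hcc] at h3
    have h4 : c * ⟪z, z⟫_ℂ = 0 := by linear_combination (-1 / 2 : ℂ) * h3
    exact inner_self_eq_zero.1 ((mul_eq_zero.1 h4).resolve_left hc0)
  let e : S.domain ≃ₗ[ℂ] H := LinearEquiv.ofBijective T ⟨hinj, LinearMap.range_eq_top.1 hsurj⟩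
  have he : ∀ y, T (e.symm y) = y := fun y => e.apply_symm_apply y
  refine ⟨LinearMap.mkContinuous (S.domain.subtype ∘ₗ e.symm.toLinearMap) 1 fun y => ?_, fun y => ?_⟩
  · rw [one_mul]
    simpa [he y] using hle (e.symm y)
  · exact ⟨(e.symm y).2, he y⟩

/-- The resolvent `(S + i)⁻¹` of a self-adjoint operator: the bounded operator `R` with
`R y ∈ D(S)` and `(S + i) R y = y` for all `y`. -/
def resolventI (hS : IsSelfAdjoint S) : H →L[ℂ] H :=
  (exists_resolvent hS (Or.inl rfl : Complex.I = Complex.I ∨ _)).choose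

theorem resolventI_spec (hS : IsSelfAdjoint S) (y : H) :
    ∃ h : resolventI hS y ∈ S.domain,
      S ⟨resolventI hS y, h⟩ + Complex.I • resolventI hS y = y :=
  (exists_resolvent hS (Or.inl rfl : Complex.I = Complex.I ∨ _)).choose_spec y

theorem resolvent_left_inv (hS : IsSelfAdjoint S) {c : ℂ} (hc : c = Complex.I ∨ c = -Complex.I)
    {R : H →L[ℂ] H} (hR : ∀ y : H, ∃ h : R y ∈ S.domain, S ⟨R y, h⟩ + c • R y = y)
    (x : S.domain) : R (S x + c • (x : H)) = x := by
  obtain ⟨h, h'⟩ := hR (S x + c • (x : H))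
  have h1 := norm_le_norm_add_smul hS hc (⟨_, h⟩ - x)
  have h2 : S (⟨_, h⟩ - x) + c • ((⟨_, h⟩ - x : S.domain) : H) = 0 := by
    rw [LinearPMap.map_sub, Submodule.coe_sub, smul_sub]
    rw [← sub_eq_zero] at h'
    rw [← h']
    abel
  rw [h2, norm_zero] at h1
  exact sub_eq_zero.1 (norm_le_zero_iff.1 h1)

theorem resolventI_apply (hS : IsSelfAdjoint S) (x : S.domain) :
    resolventI hS (S x + Complex.I • (x : H)) = x :=
  resolvent_left_inv hS (Or.inl rfl) (resolventI_spec hS) x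

/-- `(S + i)⁻¹` is normal and its adjoint is `(S - i)⁻¹`. -/
theorem resolventI_normal (hS : IsSelfAdjoint S) :
    IsStarNormal (resolventI hS) ∧ star (resolventI hS) - resolventI hS =
      (2 * Complex.I) • (star (resolventI hS) * resolventI hS) := by
  obtain ⟨R', hR'⟩ := exists_resolvent hS (Or.inr rfl : -Complex.I = Complex.I ∨ _)
  have hR := resolventI_spec hS
  set R := resolventI hS with hRdef
  have hstar : star R = R' := by
    rw [ContinuousLinearMap.star_eq_adjoint, eq_comm, ContinuousLinearMap.eq_adjoint_iff]
    intro u v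
    obtain ⟨h1, h1'⟩ := hR' u
    obtain ⟨h2, h2'⟩ := hR v
    have h3 := inner_symm_of_isSelfAdjoint hS ⟨_, h1⟩ ⟨_, h2⟩
    conv_lhs => rw [← h2']
    conv_rhs => rw [← h1']
    rw [inner_add_left, inner_add_right, inner_smul_left, inner_smul_right, h3]
    simp
  have e1 : R' = R + (2 * Complex.I) • (R * R') := by
    ext y
    obtain ⟨h1, h1'⟩ := hR' y
    have := resolvent_left_inv hS (Or.inl rfl) hR ⟨_, h1⟩
    have h4 : S ⟨R' y, h1⟩ + Complex.I • R' y = y + (2 * Complex.I) • R' y := by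
      rw [add_comm, ← eq_sub_iff_add_eq] at h1'
      rw [eq_sub_iff_add_eq, add_comm, ← eq_sub_iff_add_eq] at h1'
      rw [h1']
      module
    simp only at this
    rw [h4, map_add, map_smul] at this
    simpa using this.symm
  have e2 : R = R' - (2 * Complex.I) • (R' * R) := by
    ext y
    obtain ⟨h1, h1'⟩ := hR y
    have := resolvent_left_inv hS (Or.inr rfl) hR' ⟨_, h1⟩
    have h4 : S ⟨R y, h1⟩ + (-Complex.I) • R y = y - (2 * Complex.I) • R y := by
      rw [← eq_sub_iff_add_eq] at h1'
      rw [h1']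
      module
    simp only at this
    rw [h4, map_sub, map_smul] at this
    simpa using this.symm
  have e3 : R' - R = (2 * Complex.I) • (R' * R) := by
    rw [sub_eq_iff_eq_add]
    rw [eq_sub_iff_add_eq] at e2
    rw [add_comm]
    exact e2.symm
  have e4 : R' - R = (2 * Complex.I) • (R * R') := by
    rw [sub_eq_iff_eq_add, add_comm]
    exact e1
  have e5 : R' * R = R * R' := by
    have : (2 * Complex.I) ≠ 0 := by simp
    exact smul_right_injective _ this (e3.symm.trans e4)
  rw [hstar]
  exact ⟨⟨by rw [hstar]; exact e5⟩, e3⟩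

theorem im_of_mem_spectrum (hS : IsSelfAdjoint S) {z : ℂ}
    (hz : z ∈ spectrum ℂ (resolventI hS)) : z.im = -‖z‖ ^ 2 := by
  obtain ⟨hn, hid⟩ := resolventI_normal hS
  set R := resolventI hS
  have h1 : cfc (fun w : ℂ => star w - w - (2 * Complex.I) * (star w * w)) R = 0 := by
    rw [cfc_sub _ _ R, cfc_sub _ _ R, cfc_const_mul _ _ R, cfc_mul _ _ R, cfc_star_id (R := ℂ) R,
      cfc_id' ℂ R, hid, sub_self]
  have h2 := cfc_map_spectrum (R := ℂ) (fun w : ℂ => star w - w - (2 * Complex.I) * (star w * w)) R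
  have h3 : star z - z - (2 * Complex.I) * (star z * z) ∈ spectrum ℂ (0 : H →L[ℂ] H) := by
    rw [← h1, h2]
    exact ⟨z, hz, rfl⟩
  have : Nontrivial (H →L[ℂ] H) := by
    by_contra hnt
    rw [not_nontrivial_iff_subsingleton] at hnt
    simp [spectrum.of_subsingleton] at hz
  rw [spectrum.zero_eq, Set.mem_singleton_iff] at h3
  have h4 := congrArg Complex.im h3
  rw [← Complex.normSq_eq_norm_sq, Complex.normSq_apply]
  simp at h4
  linarith

end Resolvent

section FunctionalCalculus

/-- The function `z ↦ f(s)`, `z = (s + i)⁻¹`, extended by `0` to `z = 0` (that is, `s = ∞`). -/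
def pullback (f : ℝ → ℂ) (z : ℂ) : ℂ := if z = 0 then 0 else f (z⁻¹).re

/-- The operator `f(S)` of the functional calculus of a self-adjoint operator `S`, for `f`
continuous and vanishing at infinity: with `R = (S + i)⁻¹`, which is bounded and normal with
spectrum in `{(s + i)⁻¹ | s ∈ ℝ} ∪ {0}`, one has `f(S) = g(R)` for `g((s + i)⁻¹) = f(s)`,
`g(0) = 0`. -/
def funCalc {S : H →ₗ.[ℂ] H} (hS : IsSelfAdjoint S) (f : ℝ → ℂ) : H →L[ℂ] H :=
  cfc (pullback f) (resolventI hS)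

/-- Continuous functions decreasing faster than any inverse power. -/
def RapidlyDecreasing (f : ℝ → ℂ) : Prop :=
  Continuous f ∧ ∀ k : ℕ, ∃ C : ℝ, ∀ x : ℝ, |x| ^ k * ‖f x‖ ≤ C

variable {S : H →ₗ.[ℂ] H}

theorem RapidlyDecreasing.mul {f : ℝ → ℂ} (hf : RapidlyDecreasing f) :
    RapidlyDecreasing fun x => (x + Complex.I) * f x := by
  refine ⟨by have := hf.1; fun_prop, fun k => ?_⟩
  obtain ⟨C, hC⟩ := hf.2 k
  obtain ⟨C', hC'⟩ := hf.2 (k + 1)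
  refine ⟨C' + C, fun x => ?_⟩
  have h1 : ‖(x : ℂ) + Complex.I‖ ≤ |x| + 1 := by
    refine (norm_add_le _ _).trans ?_
    simp
  rw [norm_mul]
  calc |x| ^ k * (‖(x : ℂ) + Complex.I‖ * ‖f x‖) ≤ |x| ^ k * ((|x| + 1) * ‖f x‖) := by gcongr
    _ = |x| ^ (k + 1) * ‖f x‖ + |x| ^ k * ‖f x‖ := by ring
    _ ≤ C' + C := add_le_add (hC' x) (hC x)

theorem inv_of_mem_spectrum (hS : IsSelfAdjoint S) {z : ℂ} (hz : z ∈ spectrum ℂ (resolventI hS)) (h0 : z ≠ 0) :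
    z⁻¹ = ((z⁻¹).re : ℂ) + Complex.I := by
  have h1 := im_of_mem_spectrum hS hz
  have h2 : (z⁻¹).im = 1 := by
    rw [Complex.inv_im, h1, Complex.normSq_eq_norm_sq, neg_neg, div_self]
    simpa using h0
  apply Complex.ext <;> simp [h2]

theorem continuousOn_pullback (hS : IsSelfAdjoint S) {f : ℝ → ℂ} (hf : RapidlyDecreasing f) :
    ContinuousOn (pullback f) (spectrum ℂ (resolventI hS)) := by
  intro z hz
  by_cases h0 : z = 0
  · subst h0
    obtain ⟨C, hC⟩ := hf.mul.2 0
    have hb : ∀ w ∈ spectrum ℂ (resolventI hS), ‖pullback f w‖ ≤ C * ‖w‖ := by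
      intro w hw
      by_cases hw0 : w = 0
      · simp [pullback, hw0]
      · have h1 := hC (w⁻¹).re
        have h1 : |(w⁻¹).re| ^ 0 * ‖(((w⁻¹).re : ℂ) + Complex.I) * f (w⁻¹).re‖ ≤ C := hC _
        rw [← inv_of_mem_spectrum hS hw hw0, pow_zero, one_mul, norm_mul, norm_inv] at h1
        have hpos : 0 < ‖w‖ := norm_pos_iff.2 hw0
        rw [pullback, if_neg hw0]
        rwa [inv_mul_le_iff₀ hpos, mul_comm] at h1
    have h00 : pullback f 0 = 0 := by simp [pullback]
    rw [ContinuousWithinAt, h00]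
    refine squeeze_zero_norm' (a := fun w => C * ‖w‖)
      (eventually_nhdsWithin_of_forall hb) ?_
    have : Continuous fun w : ℂ => C * ‖w‖ := by fun_prop
    simpa using (this.tendsto 0).mono_left nhdsWithin_le_nhds
  · apply ContinuousAt.continuousWithinAt
    have h1 : ContinuousAt (fun w : ℂ => f (w⁻¹).re) z :=
      hf.1.continuousAt.comp (Complex.continuous_re.continuousAt.comp (continuousAt_inv₀ h0))
    refine h1.congr ?_
    filter_upwards [isOpen_ne.mem_nhds h0] with w hw
    rw [pullback, if_neg hw]

/-- `f(S) = (S + i)⁻¹ ((s + i) f)(S)`. -/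
theorem funCalc_eq_resolventI_mul (hS : IsSelfAdjoint S) {f : ℝ → ℂ} (hf : RapidlyDecreasing f) :
    funCalc hS f = resolventI hS * funCalc hS fun x => (x + Complex.I) * f x := by
  have hn := (resolventI_normal hS).1
  have h1 := cfc_mul (fun z : ℂ => z) (pullback fun x => (x + Complex.I) * f x) (resolventI hS)
    continuousOn_id (continuousOn_pullback hS hf.mul)
  rw [cfc_id' ℂ (resolventI hS)] at h1
  rw [funCalc, funCalc, ← h1]
  refine cfc_congr fun z hz => ?_
  by_cases h0 : z = 0
  · simp [pullback, h0]
  · simp only [pullback, if_neg h0]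
    rw [← inv_of_mem_spectrum hS hz h0, ← mul_assoc, mul_inv_cancel₀ h0, one_mul]

theorem funCalc_mem_domain_opPow (hS : IsSelfAdjoint S) (n : ℕ) {f : ℝ → ℂ} (hf : RapidlyDecreasing f) (y : H) :
    funCalc hS f y ∈ (opPow S n).domain := by
  induction n generalizing f with
  | zero => exact Submodule.mem_top
  | succ n ih =>
    have h1 := ih hf
    have h2 := ih hf.mul
    rw [funCalc_eq_resolventI_mul hS hf, mul_apply_eq_comp] at h1 ⊢
    obtain ⟨h, h'⟩ := resolventI_spec hS (funCalc hS (fun x => (x + Complex.I) * f x) y)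
    refine mem_pcomp_domain.2 ⟨h, ?_⟩
    rw [eq_sub_of_add_eq h']
    exact Submodule.sub_mem _ h2 (Submodule.smul_mem _ _ h1)

/-- `f(S)` maps the whole space into `D^∞(S)`. -/
theorem funCalc_mem_smoothDomain (hS : IsSelfAdjoint S) {f : ℝ → ℂ} (hf : RapidlyDecreasing f) (y : H) :
    funCalc hS f y ∈ smoothDomain S :=
  mem_smoothDomain.2 fun n => funCalc_mem_domain_opPow hS n hf y

theorem star_funCalc (hS : IsSelfAdjoint S) (f : ℝ → ℝ) :
    star (funCalc hS fun x => (f x : ℂ)) = funCalc hS fun x => (f x : ℂ) := by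
  rw [funCalc, ← cfc_star]
  congr 1
  funext z
  by_cases h0 : z = 0 <;> simp [pullback, h0]

theorem rapidlyDecreasing_gaussian {c : ℝ} (hc : 0 < c) :
    RapidlyDecreasing fun x => ((Real.exp (-(c * x ^ 2)) : ℝ) : ℂ) := by
  refine ⟨by fun_prop, fun k => ⟨1 + k.factorial / c ^ k, fun x => ?_⟩⟩
  have h1 := Real.pow_div_factorial_le_exp (c * x ^ 2) (by positivity) k
  have h2 : 1 ≤ Real.exp (c * x ^ 2) := Real.one_le_exp (by positivity)
  have h3 : |x| ^ k ≤ 1 + (x ^ 2) ^ k := by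
    rw [← sq_abs, ← pow_mul, mul_comm 2 k, pow_mul]
    nlinarith [sq_nonneg (|x| ^ k - 1), sq_nonneg (|x| ^ k)]
  rw [Complex.norm_real, Real.norm_eq_abs, abs_of_pos (Real.exp_pos _), Real.exp_neg,
    ← div_eq_mul_inv, div_le_iff₀ (Real.exp_pos _), add_mul, one_mul]
  refine h3.trans (add_le_add h2 ?_)
  rw [mul_pow, div_le_iff₀ (by positivity)] at h1
  rw [div_mul_eq_mul_div, le_div_iff₀ (by positivity)]
  linarith

/-- `D^∞(S)` is dense. -/
theorem dense_smoothDomain (hS : IsSelfAdjoint S) : Dense (smoothDomain S : Set H) := by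
  have hn := (resolventI_normal hS).1
  have hdom : (S.domain : Set H) ⊆ closure (smoothDomain S : Set H) := by
    intro x hx
    set y := S ⟨x, hx⟩ + Complex.I • x with hy
    have hxy : resolventI hS y = x := resolventI_apply hS ⟨x, hx⟩
    set G : ℕ → ℝ → ℂ := fun n x => ((Real.exp (-((1 / ((n : ℝ) + 1)) * x ^ 2)) : ℝ) : ℂ) with hG
    have hGr : ∀ n, RapidlyDecreasing (G n) := fun n => rapidlyDecreasing_gaussian (by positivity)
    have hbound : ∀ n : ℕ, ‖funCalc hS (G n) * resolventI hS - resolventI hS‖ ≤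
        Real.sqrt (1 / ((n : ℝ) + 1)) := by
      intro n
      have hc := continuousOn_pullback hS (hGr n)
      have e : funCalc hS (G n) * resolventI hS - resolventI hS =
          cfc (fun z : ℂ => pullback (G n) z * z - z) (resolventI hS) := by
        rw [cfc_sub (fun z => pullback (G n) z * z) (fun z => z) (resolventI hS)
            (hc.mul continuousOn_id) continuousOn_id,
          cfc_mul (pullback (G n)) (fun z => z) (resolventI hS) hc continuousOn_id,
          cfc_id' ℂ (resolventI hS), funCalc]
      rw [e]
      refine norm_cfc_le (Real.sqrt_nonneg _) fun z hz => ?_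
      by_cases h0 : z = 0
      · simp [h0]
      · have hinv := inv_of_mem_spectrum hS hz h0
        set s := (z⁻¹).re
        have hzn : |s| * ‖z‖ ≤ 1 := by
          have h1 : |s| ≤ ‖z⁻¹‖ := Complex.abs_re_le_norm _
          rw [norm_inv] at h1
          rwa [inv_eq_one_div, le_div_iff₀ (norm_pos_iff.2 h0)] at h1
        have ht : 0 ≤ 1 / ((n : ℝ) + 1) * s ^ 2 := by positivity
        have h2 : |Real.exp (-(1 / ((n : ℝ) + 1) * s ^ 2)) - 1| ≤
            Real.sqrt (1 / ((n : ℝ) + 1)) * |s| := by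
          rw [← Real.sqrt_sq_eq_abs s, ← Real.sqrt_mul (by positivity)]
          set t := 1 / ((n : ℝ) + 1) * s ^ 2
          have h3 : Real.exp (-t) ≤ 1 := Real.exp_le_one_iff.2 (by linarith)
          have h4 := Real.add_one_le_exp (-t)
          have h5 := Real.exp_pos (-t)
          rw [abs_of_nonpos (by linarith)]
          apply Real.le_sqrt_of_sq_le
          nlinarith
        have h3 : pullback (G n) z * z - z =
            ((Real.exp (-(1 / ((n : ℝ) + 1) * s ^ 2)) - 1 : ℝ) : ℂ) * z := by
          rw [pullback, if_neg h0, hG]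
          push_cast
          ring
        rw [h3, norm_mul, Complex.norm_real, Real.norm_eq_abs]
        calc _ ≤ Real.sqrt (1 / ((n : ℝ) + 1)) * |s| * ‖z‖ := by gcongr
          _ = Real.sqrt (1 / ((n : ℝ) + 1)) * (|s| * ‖z‖) := by ring
          _ ≤ Real.sqrt (1 / ((n : ℝ) + 1)) * 1 := by gcongr
          _ = _ := mul_one _
    have hlim : Tendsto (fun n => funCalc hS (G n) x) atTop (𝓝 x) := by
      rw [tendsto_iff_norm_sub_tendsto_zero]
      refine squeeze_zero (g := fun n : ℕ => Real.sqrt (1 / ((n : ℝ) + 1)) * ‖y‖)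
        (fun n => norm_nonneg _) (fun n => ?_) ?_
      · have := (funCalc hS (G n) * resolventI hS - resolventI hS).le_of_opNorm_le (hbound n) y
        simpa [hxy] using this
      · have h1 := (Real.continuous_sqrt.tendsto 0).comp (tendsto_one_div_add_atTop_nhds_zero_nat (𝕜 := ℝ))
        simpa using h1.mul_const ‖y‖
    exact mem_closure_of_tendsto hlim
      (Eventually.of_forall fun n => funCalc_mem_smoothDomain hS (hGr n) x)
  intro x
  exact closure_minimal hdom isClosed_closure (hS.dense_domain x)

end FunctionalCalculus

section QuasiUniformTopology

/-- The class of positive, bounded and continuous functions `f` with `sup_x |x|^k f(x) < ∞` for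
`k = 0, 1, …`. -/
structure RapidFun where
  toFun : ℝ → ℝ
  pos : ∀ x, 0 < toFun x
  continuous : Continuous toFun
  decay : ∀ k : ℕ, ∃ C : ℝ, ∀ x : ℝ, |x| ^ k * toFun x ≤ C

theorem RapidFun.rapidlyDecreasing (f : RapidFun) :
    RapidlyDecreasing fun x => (f.toFun x : ℂ) := by
  refine ⟨by have := f.continuous; fun_prop, fun k => ?_⟩
  obtain ⟨C, hC⟩ := f.decay k
  refine ⟨C, fun x => ?_⟩
  rw [Complex.norm_real, Real.norm_eq_abs, abs_of_pos (f.pos x)]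
  exact hC x

variable {S : H →ₗ.[ℂ] H} {D : Submodule ℂ H}

/-- `f(S)` as an operator from the whole space to `D = D^∞(S)`. -/
def funCalcD (hS : IsSelfAdjoint S) (hD : D = smoothDomain S)
    (f : RapidFun) : H →ₗ[ℂ] D :=
  LinearMap.codRestrict D (funCalc hS fun x => (f.toFun x : ℂ)).toLinearMap
    fun y => hD.symm ▸ funCalc_mem_smoothDomain hS f.rapidlyDecreasing y

theorem inner_funCalcD (hS : IsSelfAdjoint S) (hD : D = smoothDomain S)
    (f : RapidFun) (x y : H) :
    ⟪x, (funCalcD hS hD f y : H)⟫_ℂ = ⟪(funCalcD hS hD f x : H), y⟫_ℂ := by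
  have h := star_funCalc hS f.toFun
  rw [ContinuousLinearMap.star_eq_adjoint] at h
  have := ContinuousLinearMap.adjoint_inner_left (funCalc hS fun x => (f.toFun x : ℂ)) y x
  rw [h] at this
  exact this.symm

theorem restr_mem_LDagger (hS : IsSelfAdjoint S) (hD : D = smoothDomain S)
    : restr S hD ∈ LDagger D :=
  continuous_weak_iff_exists.2 ⟨restr S hD, fun ψ φ =>
    inner_symm_of_isSelfAdjoint hS ⟨ψ, smoothDomain_le S (hD.le ψ.2)⟩
      ⟨φ, smoothDomain_le S (hD.le φ.2)⟩⟩

/-- `A f(S)` is bounded for `A ∈ L†(D)`. -/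
theorem continuous_comp_funCalcD (hS : IsSelfAdjoint S) (hD : D = smoothDomain S)
    {A : Module.End ℂ D} (hA : A ∈ LDagger D) (f : RapidFun) :
    Continuous (D.subtype ∘ₗ A ∘ₗ funCalcD hS hD f) := by
  obtain ⟨B, hB⟩ := continuous_weak_iff_exists.1 hA
  refine LinearMap.continuous_of_seq_closed_graph _ fun u x y hu hy => ?_
  have hdense : Dense (D : Set H) := hD ▸ dense_smoothDomain hS
  refine hdense.eq_of_inner_right ℂ fun ψ hψ => ?_
  have h1 : ∀ v : H, ⟪ψ, (D.subtype ∘ₗ A ∘ₗ funCalcD hS hD f) v⟫_ℂ =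
      ⟪(B ⟨ψ, hψ⟩ : H), funCalc hS (fun x => (f.toFun x : ℂ)) v⟫_ℂ := fun v =>
    (hB ⟨ψ, hψ⟩ (funCalcD hS hD f v)).symm
  have h2 : Tendsto (fun n => ⟪ψ, (D.subtype ∘ₗ A ∘ₗ funCalcD hS hD f) (u n)⟫_ℂ) atTop
      (𝓝 ⟪ψ, y⟫_ℂ) := tendsto_const_nhds.inner hy
  have h3 : Tendsto (fun n => ⟪ψ, (D.subtype ∘ₗ A ∘ₗ funCalcD hS hD f) (u n)⟫_ℂ) atTop
      (𝓝 ⟪ψ, (D.subtype ∘ₗ A ∘ₗ funCalcD hS hD f) x⟫_ℂ) := by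
    simp_rw [h1]
    exact tendsto_const_nhds.inner (((funCalc hS _).continuous.tendsto x).comp hu)
  exact tendsto_nhds_unique h2 h3

/-- `f(S) A` is bounded on `D` for `A ∈ L†(D)`. -/
theorem continuous_funCalcD_comp (hS : IsSelfAdjoint S) (hD : D = smoothDomain S)
    {A : Module.End ℂ D} (hA : A ∈ LDagger D) (f : RapidFun) :
    Continuous (D.subtype ∘ₗ funCalcD hS hD f ∘ₗ D.subtype ∘ₗ A) := by
  obtain ⟨B, hB⟩ := continuous_weak_iff_exists.1 hA
  have hB' : B ∈ LDagger D := continuous_weak_iff_exists.2 ⟨A, fun ψ φ => by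
    rw [← inner_conj_symm, ← hB, inner_conj_symm]⟩
  let T : H →L[ℂ] H := ⟨_, continuous_comp_funCalcD hS hD hB' f⟩
  have h : ∀ φ : D, (D.subtype ∘ₗ funCalcD hS hD f ∘ₗ D.subtype ∘ₗ A) φ =
      ContinuousLinearMap.adjoint T (φ : H) := by
    intro φ
    refine ext_inner_left ℂ fun v => ?_
    rw [ContinuousLinearMap.adjoint_inner_right]
    change ⟪v, (funCalcD hS hD f (A φ : H) : H)⟫_ℂ = ⟪(B (funCalcD hS hD f v) : H), (φ : H)⟫_ℂ
    rw [inner_funCalcD, hB]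
  have h' : Continuous fun φ : D => ContinuousLinearMap.adjoint T (φ : H) := by fun_prop
  exact h'.congr fun φ => (h φ).symm

/-- The map `A ↦ Sᵏ A f(S)` from `L†(D)` to the bounded operators. -/
def leftMap (hS : IsSelfAdjoint S) (hD : D = smoothDomain S)
    (f : RapidFun) (k : ℕ) : LDagger D →ₗ[ℂ] (H →L[ℂ] H) where
  toFun A := ⟨D.subtype ∘ₗ (restr S hD ^ k * A.1) ∘ₗ funCalcD hS hD f,
    continuous_comp_funCalcD hS hD
      (mul_mem_LDagger (pow_mem_LDagger (restr_mem_LDagger hS hD) k) A.2) f⟩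
  map_add' A B := by ext; simp
  map_smul' c A := by ext; simp

/-- The map taking `A ∈ L†(D)` to the bounded operator `f(S) A Sᵏ`, defined on the dense
subspace `D` (with the norm of the Hilbert space). -/
def rightMap (hS : IsSelfAdjoint S) (hD : D = smoothDomain S)
    (f : RapidFun) (k : ℕ) : LDagger D →ₗ[ℂ] (D →L[ℂ] H) where
  toFun A := ⟨D.subtype ∘ₗ funCalcD hS hD f ∘ₗ D.subtype ∘ₗ (A.1 * restr S hD ^ k),
    continuous_funCalcD_comp hS hD
      (mul_mem_LDagger A.2 (pow_mem_LDagger (restr_mem_LDagger hS hD) k)) f⟩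
  map_add' A B := by ext; simp
  map_smul' c A := by ext; simp

theorem leftMap_apply (hS : IsSelfAdjoint S) (hD : D = smoothDomain S)
    (f : RapidFun) (k : ℕ) (A : LDagger D) (y : H) :
    leftMap hS hD f k A y = ((restr S hD ^ k) (A.1 (funCalcD hS hD f y)) : H) := rfl

theorem rightMap_apply (hS : IsSelfAdjoint S) (hD : D = smoothDomain S)
    (f : RapidFun) (k : ℕ) (A : LDagger D) (φ : D) :
    rightMap hS hD f k A φ =
      funCalc hS (fun x => (f.toFun x : ℂ)) (A.1 ((restr S hD ^ k) φ) : H) := rfl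

/-- The seminorm `A ↦ max {‖Sᵏ A f(S)‖, ‖f(S) A Sᵏ‖}` on `L†(D)`, where the norms are
operator norms. -/
def quasiUniformSeminorm (hS : IsSelfAdjoint S) (hD : D = smoothDomain S)
    (i : RapidFun × ℕ) : Seminorm ℂ (LDagger D) :=
  (normSeminorm ℂ (H →L[ℂ] H)).comp (leftMap hS hD i.1 i.2) ⊔
    (normSeminorm ℂ (D →L[ℂ] H)).comp (rightMap hS hD i.1 i.2)

/-- The quasi-uniform topology on `L†(D)`, `D = D^∞(S)`, defined by the seminorms
`A ↦ max {‖Sᵏ A f(S)‖, ‖f(S) A Sᵏ‖}`. -/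
abbrev quasiUniformTopology (hS : IsSelfAdjoint S) (hD : D = smoothDomain S)
    : TopologicalSpace (LDagger D) :=
  seminormTopology (quasiUniformSeminorm hS hD)

theorem quasiUniformSeminorm_apply (hS : IsSelfAdjoint S) (hD : D = smoothDomain S)
    (f : RapidFun) (k : ℕ) (A : LDagger D) :
    quasiUniformSeminorm hS hD (f, k) A =
      max ‖leftMap hS hD f k A‖ ‖rightMap hS hD f k A‖ := rfl

end QuasiUniformTopology

end QuasiUniform

end

/-! The situation is symmetric in two self-adjoint operators S and T with the same smooth domain D,
so each topology only has to be compared with the other in one direction. Two principles carry the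
argument.

Automatic continuity. An operator A of L†(D) need not be norm continuous, but its adjoint on D makes
φ ↦ ‖Aφ‖ lower semicontinuous for the Hilbert space norm (`norm_apply_le_of_tendsto`). Since S is
closed, (D, t_S) is a Fréchet space, and on a Fréchet space a lower semicontinuous seminorm is
continuous by Baire's theorem. Hence ‖Aφ‖ ≤ C ∑ ‖Sʲφ‖ over finitely many j
(`exists_norm_apply_le_sum`). The powers of T are symmetric on D and so belong to L†(D); taking A =
Tᵏ gives (1).

Absorption into g(S). By the first principle it suffices for (2) to bound ‖Sʲ A f(T) y‖. The vectors
φ = f(T) y satisfy ‖Sⁿφ‖ ≤ cₙ‖y‖, because Sⁿ f(T) is bounded by the closed graph theorem. Choose aₙ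
> 0 so small that ∑ aₙ c₂ₙ ≤ e and put g = 1 / ∑ aₙ x²ⁿ, which is rapidly decreasing. Formally φ =
g(S) z with z = ∑ aₙ S²ⁿφ and ‖z‖ ≤ e‖y‖. With partial sums in place of z this becomes a limit
(`exists_rapidFun_tendsto`), and lower semicontinuity yields ‖Sʲ A φ‖ ≤ e ‖Sʲ A g(S)‖ ‖y‖
(`exists_norm_leftMap_le`). The other half of the seminorm follows by passing to adjoints
(`norm_rightMap`). -/

namespace QuasiUniform

/-! ### Automatic continuity of the operators in L†(D) with respect to the graph topology -/

section Bounds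

variable {H : Type*} [NormedAddCommGroup H] [InnerProductSpace ℂ H] {D : Submodule ℂ H}

/-- The operators of `L†(D)` are lower semicontinuous in norm. -/
theorem norm_apply_le_of_tendsto (hdense : Dense (D : Set H)) {A : Module.End ℂ D}
    (hA : A ∈ LDagger D) {φ : D} {u : ℕ → D} {M : ℝ}
    (hu : Tendsto (fun n => (u n : H)) atTop (𝓝 (φ : H)))
    (hM : ∀ n, ‖(A (u n) : H)‖ ≤ M) : ‖(A φ : H)‖ ≤ M := by
  obtain ⟨B, hB⟩ := continuous_weak_iff_exists.1 hA
  have hM0 : 0 ≤ M := (norm_nonneg _).trans (hM 0)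
  -- For ψ in D the adjoint moves A off the sequence, and the inner product is norm continuous;
  -- density then gives all ψ, in particular ψ = Aφ.
  have key : ∀ ψ : H, ‖⟪ψ, (A φ : H)⟫_ℂ‖ ≤ M * ‖ψ‖ := by
    intro ψ
    refine hdense.induction (P := fun ψ => ‖⟪ψ, (A φ : H)⟫_ℂ‖ ≤ M * ‖ψ‖) (fun ψ hψ => ?_)
      (isClosed_le (by fun_prop) (by fun_prop)) ψ
    have h1 : Tendsto (fun n => ‖⟪(B ⟨ψ, hψ⟩ : H), (u n : H)⟫_ℂ‖) atTop
        (𝓝 ‖⟪(B ⟨ψ, hψ⟩ : H), (φ : H)⟫_ℂ‖) := (tendsto_const_nhds.inner hu).norm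
    rw [hB] at h1
    refine le_of_tendsto h1 (Eventually.of_forall fun n => ?_)
    rw [hB, mul_comm]
    exact (norm_inner_le_norm _ _).trans (mul_le_mul_of_nonneg_left (hM n) (norm_nonneg _))
  have h2 := key (A φ : H)
  rw [inner_self_eq_norm_sq_to_K, norm_pow, RCLike.norm_ofReal, abs_norm, sq] at h2
  by_contra! hlt
  have := hM0.trans_lt hlt
  nlinarith

variable {S : H →ₗ.[ℂ] H}

/-- The embedding `φ ↦ (Sⁿ φ)ₙ` of `D^∞(S)` into the space of sequences. -/
def orbit (S : H →ₗ.[ℂ] H) (hD : D = smoothDomain S) : D →ₗ[ℂ] (ℕ → H) :=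
  LinearMap.pi fun n => D.subtype ∘ₗ (restr S hD ^ n)

theorem orbit_apply (hD : D = smoothDomain S) (φ : D) (n : ℕ) :
    orbit S hD φ n = ((restr S hD ^ n) φ : H) := rfl

variable [CompleteSpace H]

/-- This is the completeness of (D, t_S). If orbits converge coordinatewise to w, closedness of the
graph of S gives S wₙ = wₙ₊₁ for every n, so w₀ is a smooth vector and w is its orbit. -/
theorem isClosed_range_orbit (hS : IsSelfAdjoint S) (hD : D = smoothDomain S) :
    IsClosed (LinearMap.range (orbit S hD) : Set (ℕ → H)) := by
  refine IsSeqClosed.isClosed fun v w hv hvw => ?_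
  choose φ hφ using hv
  rw [tendsto_pi_nhds] at hvw
  have hmem : ∀ n, ∃ h : w n ∈ S.domain, S ⟨w n, h⟩ = w (n + 1) := by
    intro n
    have hcl : IsClosed (S.graph : Set (H × H)) := hS.isClosed
    have hg : (w n, w (n + 1)) ∈ S.graph := by
      refine hcl.mem_of_tendsto ((hvw n).prodMk_nhds (hvw (n + 1)))
        (Eventually.of_forall fun m => ?_)
      rw [← hφ, orbit_apply, orbit_apply, pow_succ', Module.End.mul_apply, coe_restr_apply]
      exact S.mem_graph ⟨_, smoothDomain_le S (hD.le ((restr S hD ^ n) (φ m)).2)⟩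
    obtain ⟨b, hb1, hb2⟩ := (LinearPMap.mem_graph_iff _).1 hg
    simp only at hb1 hb2
    exact ⟨hb1 ▸ b.2, by rw [← hb2]; congr 1; exact Subtype.ext hb1.symm⟩
  have hpow : ∀ n k, w k ∈ (opPow S n).domain := by
    intro n
    induction n with
    | zero => exact fun k => Submodule.mem_top
    | succ n ih =>
      intro k
      obtain ⟨h, h'⟩ := hmem k
      exact mem_pcomp_domain.2 ⟨h, h' ▸ ih (k + 1)⟩
  have h0 : w 0 ∈ D := hD.symm ▸ mem_smoothDomain.2 fun n => hpow n 0
  refine ⟨⟨w 0, h0⟩, funext fun n => ?_⟩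
  rw [orbit_apply]
  induction n with
  | zero => rfl
  | succ n ih =>
    obtain ⟨h, h'⟩ := hmem n
    rw [pow_succ', Module.End.mul_apply, coe_restr_apply, ← h']
    congr 1
    exact Subtype.ext ih

/-- Every operator of `L†(D)`, `D = D^∞(S)`, is bounded from `D` with the topology `t_S` to the
Hilbert space. -/
theorem exists_norm_apply_le_sum (hS : IsSelfAdjoint S) (hD : D = smoothDomain S)
    {A : Module.End ℂ D} (hA : A ∈ LDagger D) :
    ∃ (s : Finset ℕ) (C : ℝ), 0 ≤ C ∧
      ∀ φ : D, ‖(A φ : H)‖ ≤ C * ∑ j ∈ s, ‖((restr S hD ^ j) φ : H)‖ := by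
  have hdense : Dense (D : Set H) := hD ▸ dense_smoothDomain hS
  have hinj : Function.Injective (orbit S hD) := fun a b hab => Subtype.ext (congrFun hab 0)
  let e := LinearEquiv.ofInjective (orbit S hD) hinj
  have he : ∀ (v : LinearMap.range (orbit S hD)) (n : ℕ),
      (v : ℕ → H) n = ((restr S hD ^ n) (e.symm v) : H) := fun v n => by
    conv_lhs => rw [← e.apply_symm_apply v]
    rfl
  -- A closed subspace of a countable product of Hilbert spaces is completely metrizable, hence
  -- Baire; this makes the lower semicontinuous seminorm `q` continuous.
  have : TopologicalSpace.IsCompletelyPseudoMetrizableSpace (LinearMap.range (orbit S hD)) :=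
    (isClosed_range_orbit hS hD).isClosedEmbedding_subtypeVal.IsCompletelyPseudoMetrizableSpace
  let q : Seminorm ℂ (LinearMap.range (orbit S hD)) :=
    (normSeminorm ℂ H).comp (D.subtype ∘ₗ A ∘ₗ e.symm.toLinearMap)
  have hq : Continuous q := by
    refine q.continuous_of_lowerSemicontinuous
      (lowerSemicontinuous_iff_isClosed_preimage.2 fun M => IsSeqClosed.isClosed
        fun v w hv hvw => ?_)
    -- Convergence of orbits includes convergence of the coordinate 0, that is, norm convergence of
    -- the vectors themselves.
    refine norm_apply_le_of_tendsto hdense hA (u := fun n => e.symm (v n)) ?_ hv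
    have h1 : Tendsto (fun n => (v n : ℕ → H) 0) atTop (𝓝 ((w : ℕ → H) 0)) :=
      (((continuous_apply 0).comp continuous_subtype_val).tendsto w).comp hvw
    simp only [he, pow_zero] at h1
    exact h1
  have hnhds : {v | q v < 1} ∈ 𝓝 (0 : LinearMap.range (orbit S hD)) :=
    (isOpen_lt hq continuous_const).mem_nhds (by simp)
  rw [nhds_subtype_eq_comap, mem_comap] at hnhds
  obtain ⟨t, ht, htq⟩ := hnhds
  -- A neighbourhood in the product topology constrains only finitely many coordinates; these are
  -- the powers of S that enter the bound.
  rw [ZeroMemClass.coe_zero, nhds_pi, Filter.mem_pi] at ht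
  obtain ⟨I, hI, U, hU, hUt⟩ := ht
  have hε : ∃ ε > 0, ∀ i ∈ I, ∀ x : H, ‖x‖ < ε → x ∈ U i := by
    have : (⋂ i ∈ I, U i) ∈ 𝓝 (0 : H) := (biInter_mem hI).2 fun i _ => hU i
    obtain ⟨ε, hε, h⟩ := Metric.mem_nhds_iff.1 this
    exact ⟨ε, hε, fun i hi x hx => Set.mem_iInter₂.1 (h (by simpa using hx)) i hi⟩
  obtain ⟨ε, hε, hεU⟩ := hε
  refine ⟨hI.toFinset, ε⁻¹, by positivity, fun φ => ?_⟩
  set σ := ∑ j ∈ hI.toFinset, ‖((restr S hD ^ j) φ : H)‖ with hσ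
  have hσ0 : 0 ≤ σ := Finset.sum_nonneg fun _ _ => norm_nonneg _
  have hsmall : ∀ c : ℝ, 0 < c → c * σ < ε → c * ‖(A φ : H)‖ < 1 := by
    intro c hc hcσ
    have h1 : e ((c : ℂ) • φ) ∈ (Subtype.val ⁻¹' t : Set (LinearMap.range (orbit S hD))) := by
      refine hUt fun i hi => hεU i hi _ ?_
      rw [he, e.symm_apply_apply, map_smul, Submodule.coe_smul, norm_smul, Complex.norm_real,
        Real.norm_of_nonneg hc.le]
      refine lt_of_le_of_lt (mul_le_mul_of_nonneg_left ?_ hc.le) hcσ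
      exact Finset.single_le_sum (f := fun j => ‖((restr S hD ^ j) φ : H)‖)
        (fun _ _ => norm_nonneg _) (hI.mem_toFinset.2 hi)
    have h2 : ‖(A (e.symm (e ((c : ℂ) • φ))) : H)‖ < 1 := htq h1
    rwa [e.symm_apply_apply, map_smul, Submodule.coe_smul, norm_smul, Complex.norm_real,
        Real.norm_of_nonneg hc.le] at h2
  rw [← div_eq_inv_mul, le_div_iff₀ hε]
  by_contra! hlt
  have hA0 : 0 < ‖(A φ : H)‖ := by
    rcases (norm_nonneg (A φ : H)).eq_or_lt with h | h
    · rw [← h, zero_mul] at hlt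
      exact absurd hlt (not_lt.2 hσ0)
    · exact h
  -- Scaling by ‖Aφ‖⁻¹ rather than by a multiple of σ⁻¹ avoids a separate treatment of σ = 0.
  have h3 := hsmall ‖(A φ : H)‖⁻¹ (by positivity) (by
    rwa [inv_mul_lt_iff₀ hA0])
  rw [inv_mul_cancel₀ hA0.ne'] at h3
  exact lt_irrefl _ h3

end Bounds

/-! ### Functional calculus: algebraic rules and strong convergence -/

section Calculus

variable {H : Type*} [NormedAddCommGroup H] [InnerProductSpace ℂ H]

theorem RapidlyDecreasing.ofReal_mul {f : ℝ → ℂ} (hf : RapidlyDecreasing f) :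
    RapidlyDecreasing fun x => x * f x := by
  refine ⟨by have := hf.1; fun_prop, fun k => ?_⟩
  obtain ⟨C, hC⟩ := hf.2 (k + 1)
  refine ⟨C, fun x => le_of_eq_of_le ?_ (hC x)⟩
  rw [norm_mul, Complex.norm_real, Real.norm_eq_abs]
  ring

theorem RapidlyDecreasing.const_mul {f : ℝ → ℂ} (hf : RapidlyDecreasing f) (c : ℂ) :
    RapidlyDecreasing fun x => c * f x := by
  refine ⟨by have := hf.1; fun_prop, fun k => ?_⟩
  obtain ⟨C, hC⟩ := hf.2 k
  refine ⟨‖c‖ * C, fun x => ?_⟩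
  rw [norm_mul, mul_left_comm]
  exact mul_le_mul_of_nonneg_left (hC x) (norm_nonneg c)

theorem RapidlyDecreasing.add {f g : ℝ → ℂ} (hf : RapidlyDecreasing f)
    (hg : RapidlyDecreasing g) : RapidlyDecreasing fun x => f x + g x := by
  refine ⟨hf.1.add hg.1, fun k => ?_⟩
  obtain ⟨C, hC⟩ := hf.2 k
  obtain ⟨C', hC'⟩ := hg.2 k
  refine ⟨C + C', fun x => ?_⟩
  calc |x| ^ k * ‖f x + g x‖ ≤ |x| ^ k * (‖f x‖ + ‖g x‖) := by gcongr; exact norm_add_le _ _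
    _ ≤ C + C' := by rw [mul_add]; exact add_le_add (hC x) (hC' x)

theorem rapidlyDecreasing_zero : RapidlyDecreasing fun _ => 0 :=
  ⟨continuous_const, fun k => ⟨0, fun x => by simp⟩⟩

theorem RapidlyDecreasing.ofReal_pow_mul {f : ℝ → ℂ} (hf : RapidlyDecreasing f) (n : ℕ) :
    RapidlyDecreasing fun x => (x : ℂ) ^ n * f x := by
  induction n with
  | zero => simpa using hf
  | succ n ih => simpa only [pow_succ', mul_assoc] using ih.ofReal_mul

theorem RapidlyDecreasing.sum {f : ℕ → ℝ → ℂ} (hf : ∀ n, RapidlyDecreasing (f n)) (N : ℕ) :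
    RapidlyDecreasing fun x => ∑ n ∈ Finset.range N, f n x := by
  induction N with
  | zero => simpa using rapidlyDecreasing_zero
  | succ N ih => simpa only [Finset.sum_range_succ] using ih.add (hf N)

variable [CompleteSpace H] {S : H →ₗ.[ℂ] H}

theorem funCalc_add (hS : IsSelfAdjoint S) {f g : ℝ → ℂ} (hf : RapidlyDecreasing f)
    (hg : RapidlyDecreasing g) :
    funCalc hS (fun x => f x + g x) = funCalc hS f + funCalc hS g := by
  rw [funCalc, funCalc, funCalc, ← cfc_add _ _ _ (continuousOn_pullback hS hf)
    (continuousOn_pullback hS hg)]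
  refine cfc_congr fun z _ => ?_
  by_cases h0 : z = 0 <;> simp [pullback, h0]

theorem funCalc_const_mul (hS : IsSelfAdjoint S) {f : ℝ → ℂ} (hf : RapidlyDecreasing f) (c : ℂ) :
    funCalc hS (fun x => c * f x) = c • funCalc hS f := by
  rw [funCalc, funCalc, ← cfc_const_mul _ _ _ (continuousOn_pullback hS hf)]
  refine cfc_congr fun z _ => ?_
  by_cases h0 : z = 0 <;> simp [pullback, h0]

theorem funCalc_zero (hS : IsSelfAdjoint S) : funCalc hS (fun _ => 0) = 0 := by
  have h := funCalc_const_mul hS rapidlyDecreasing_zero 0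
  simpa using h

theorem funCalc_sum (hS : IsSelfAdjoint S) {f : ℕ → ℝ → ℂ} (hf : ∀ n, RapidlyDecreasing (f n))
    (N : ℕ) : funCalc hS (fun x => ∑ n ∈ Finset.range N, f n x) =
      ∑ n ∈ Finset.range N, funCalc hS (f n) := by
  induction N with
  | zero => simpa using funCalc_zero hS
  | succ N ih =>
    simp only [Finset.sum_range_succ]
    rw [funCalc_add hS (RapidlyDecreasing.sum hf N) (hf N), ih]

/-- `f(S) = ((s + i) f)(S) (S + i)⁻¹`. -/
theorem funCalc_eq_mul_resolventI (hS : IsSelfAdjoint S) {f : ℝ → ℂ} (hf : RapidlyDecreasing f) :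
    funCalc hS f = (funCalc hS fun x => (x + Complex.I) * f x) * resolventI hS := by
  have hn := (resolventI_normal hS).1
  rw [funCalc_eq_resolventI_mul hS hf]
  conv_lhs => enter [1]; rw [← cfc_id' ℂ (resolventI hS)]
  conv_rhs => enter [2]; rw [← cfc_id' ℂ (resolventI hS)]
  exact cfc_commute_cfc _ _ _

/-- `f(S) S ⊆ (s f)(S)`. -/
theorem funCalc_apply_map (hS : IsSelfAdjoint S) {f : ℝ → ℂ} (hf : RapidlyDecreasing f)
    (x : S.domain) : funCalc hS f (S x) = funCalc hS (fun t => t * f t) x := by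
  -- The resolvent factor of f(S) cancels S + i, leaving ((s + i) f)(S) x; the term i f(S) x is then
  -- removed from both sides.
  have h1 : funCalc hS f (S x + Complex.I • (x : H)) =
      funCalc hS (fun t => t * f t) x + Complex.I • funCalc hS f x := by
    conv_lhs => rw [funCalc_eq_mul_resolventI hS hf, mul_apply_eq_comp, resolventI_apply]
    simp_rw [add_mul]
    rw [funCalc_add hS hf.ofReal_mul (hf.const_mul _), funCalc_const_mul hS hf]
    rfl
  rw [map_add, map_smul] at h1
  exact add_right_cancel h1

theorem funCalc_restr_pow {D : Submodule ℂ H} (hS : IsSelfAdjoint S) (hD : D = smoothDomain S)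
    {f : ℝ → ℂ} (hf : RapidlyDecreasing f) (n : ℕ) (φ : D) :
    funCalc hS f ((restr S hD ^ n) φ : H) = funCalc hS (fun t => (t : ℂ) ^ n * f t) φ := by
  induction n generalizing f with
  | zero => simp
  | succ n ih =>
    rw [pow_succ', Module.End.mul_apply, coe_restr_apply, funCalc_apply_map hS hf,
      ih hf.ofReal_mul]
    simp only [pow_succ, mul_assoc]

/-- `fₙ(S) → 1` strongly on `D(S)` if `fₙ → 1` locally uniformly and boundedly. -/
theorem tendsto_funCalc_apply (hS : IsSelfAdjoint S) {F : ℕ → ℝ → ℂ}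
    (hF : ∀ n, RapidlyDecreasing (F n)) (hF1 : ∀ n x, ‖F n x - 1‖ ≤ 1)
    (hlim : ∀ R ε : ℝ, 0 < ε → ∀ᶠ n in atTop, ∀ x, |x| ≤ R → ‖F n x - 1‖ ≤ ε) (x : S.domain) :
    Tendsto (fun n => funCalc hS (F n) x) atTop (𝓝 (x : H)) := by
  have hn := (resolventI_normal hS).1
  set y := S x + Complex.I • (x : H) with hy
  have hxy : resolventI hS y = x := resolventI_apply hS x
  have hbound : Tendsto (fun n => ‖funCalc hS (F n) * resolventI hS - resolventI hS‖)
      atTop (𝓝 0) := by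
    rw [Metric.tendsto_nhds]
    intro δ hδ
    -- With z = (s + i)⁻¹ the quantity to bound is |F(s) - 1| |z|. For |s| ≤ 2/δ the first factor is
    -- at most δ/2 and |z| ≤ 1; for larger |s| the first factor is at most 1 and |z| ≤ 1/|s| ≤ δ/2.
    filter_upwards [hlim (δ / 2)⁻¹ (δ / 2) (half_pos hδ)] with n hnε
    rw [dist_zero_right, norm_norm]
    refine lt_of_le_of_lt ?_ (half_lt_self hδ)
    have hc := continuousOn_pullback hS (hF n)
    have e : funCalc hS (F n) * resolventI hS - resolventI hS =
        cfc (fun z : ℂ => pullback (F n) z * z - z) (resolventI hS) := by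
      rw [cfc_sub (fun z => pullback (F n) z * z) (fun z => z) (resolventI hS)
          (hc.mul continuousOn_id) continuousOn_id,
        cfc_mul (pullback (F n)) (fun z => z) (resolventI hS) hc continuousOn_id,
        cfc_id' ℂ (resolventI hS), funCalc]
    rw [e]
    refine norm_cfc_le (half_pos hδ).le fun z hz => ?_
    by_cases h0 : z = 0
    · simpa [h0] using (half_pos hδ).le
    · have hinv := inv_of_mem_spectrum hS hz h0
      have hz0 : 0 < ‖z‖ := norm_pos_iff.2 h0
      have hz1 : ‖z‖ ≤ 1 := by
        have h1 : |(z⁻¹).im| ≤ ‖z⁻¹‖ := Complex.abs_im_le_norm _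
        rw [hinv] at h1
        simp only [Complex.add_im, Complex.ofReal_im, Complex.I_im, zero_add, abs_one] at h1
        rw [← hinv, norm_inv] at h1
        exact (one_le_inv₀ hz0).1 h1
      have h2 : pullback (F n) z * z - z = (F n (z⁻¹).re - 1) * z := by
        rw [pullback, if_neg h0]
        ring
      rw [h2, norm_mul]
      by_cases hs : |(z⁻¹).re| ≤ (δ / 2)⁻¹
      · exact (mul_le_of_le_one_right (norm_nonneg _) hz1).trans (hnε _ hs)
      · have h3 : (δ / 2)⁻¹ ≤ ‖z‖⁻¹ := by
          rw [← norm_inv]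
          exact (not_le.1 hs).le.trans (Complex.abs_re_le_norm _)
        have h4 : ‖z‖ ≤ δ / 2 := (inv_le_inv₀ (half_pos hδ) hz0).1 h3
        calc _ ≤ 1 * ‖z‖ := by gcongr; exact hF1 _ _
          _ ≤ δ / 2 := by rwa [one_mul]
  rw [tendsto_iff_norm_sub_tendsto_zero]
  refine squeeze_zero (g := fun n : ℕ => ‖funCalc hS (F n) * resolventI hS - resolventI hS‖ * ‖y‖)
    (fun n => norm_nonneg _) (fun n => ?_) ?_
  · have := (funCalc hS (F n) * resolventI hS - resolventI hS).le_opNorm y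
    simpa [hxy] using this
  · simpa using hbound.mul_const ‖y‖

end Calculus

/-! ### Rapidly decreasing reciprocals of power series -/

section Weight

variable {a : ℕ → ℝ}

/-- Domination by the exponential series of R², uniformly for |x| ≤ R: the source of convergence, of
continuity and of the uniform tail estimate. -/
theorem norm_mul_sq_pow_le (ha : ∀ n, 0 < a n) (ha' : ∀ n, a n ≤ 1 / n.factorial) {R x : ℝ}
    (hx : |x| ≤ R) (n : ℕ) : ‖a n * (x ^ 2) ^ n‖ ≤ (R ^ 2) ^ n / n.factorial := by
  have h : x ^ 2 ≤ R ^ 2 := sq_le_sq' (abs_le.1 hx).1 (abs_le.1 hx).2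
  rw [norm_mul, Real.norm_of_nonneg (ha n).le, Real.norm_of_nonneg (by positivity),
    div_eq_inv_mul, ← one_div]
  exact mul_le_mul (ha' n) (pow_le_pow_left₀ (sq_nonneg x) h n) (by positivity) (by positivity)

theorem summable_mul_sq_pow (ha : ∀ n, 0 < a n) (ha' : ∀ n, a n ≤ 1 / n.factorial) (x : ℝ) :
    Summable fun n => a n * (x ^ 2) ^ n :=
  .of_norm_bounded (Real.summable_pow_div_factorial (|x| ^ 2))
    (norm_mul_sq_pow_le ha ha' le_rfl)

theorem mul_sq_pow_le_tsum (ha : ∀ n, 0 < a n) (ha' : ∀ n, a n ≤ 1 / n.factorial) (x : ℝ) (n : ℕ) :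
    a n * (x ^ 2) ^ n ≤ ∑' m, a m * (x ^ 2) ^ m :=
  (summable_mul_sq_pow ha ha' x).le_tsum n fun m _ => mul_nonneg (ha m).le (by positivity)

theorem continuous_tsum_mul_sq_pow (ha : ∀ n, 0 < a n) (ha' : ∀ n, a n ≤ 1 / n.factorial) :
    Continuous fun x : ℝ => ∑' n, a n * (x ^ 2) ^ n := by
  rw [continuous_iff_continuousAt]
  intro x
  have h : ContinuousOn (fun x : ℝ => ∑' n, a n * (x ^ 2) ^ n) {y | |y| ≤ |x| + 1} :=
    continuousOn_tsum (fun n => by fun_prop) (Real.summable_pow_div_factorial ((|x| + 1) ^ 2))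
      fun n y hy => norm_mul_sq_pow_le ha ha' hy n
  refine h.continuousAt ?_
  filter_upwards [(isOpen_lt continuous_abs continuous_const).mem_nhds
    (show x ∈ {y : ℝ | |y| < |x| + 1} from lt_add_one |x|)] with y hy
  exact le_of_lt hy

/-- The rapidly decreasing function `1 / ∑ₙ aₙ x²ⁿ`. -/
noncomputable def invSeries (ha : ∀ n, 0 < a n) (ha' : ∀ n, a n ≤ 1 / n.factorial) : RapidFun where
  toFun x := (∑' n, a n * (x ^ 2) ^ n)⁻¹
  pos x := inv_pos.2 <| (ha 0).trans_le (by simpa using mul_sq_pow_le_tsum ha ha' x 0)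
  continuous := (continuous_tsum_mul_sq_pow ha ha').inv₀ fun x =>
    ((ha 0).trans_le (by simpa using mul_sq_pow_le_tsum ha ha' x 0)).ne'
  decay k := by
    -- |x|ᵏ ≤ 1 + x²ᵏ, and the series dominates both its term a₀ and its term aₖ x²ᵏ.
    refine ⟨(a 0)⁻¹ + (a k)⁻¹, fun x => ?_⟩
    have h0 : a 0 ≤ ∑' m, a m * (x ^ 2) ^ m := by simpa using mul_sq_pow_le_tsum ha ha' x 0
    have hk := mul_sq_pow_le_tsum ha ha' x k
    set W := ∑' m, a m * (x ^ 2) ^ m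
    have hW : 0 < W := (ha 0).trans_le h0
    have h3 : |x| ^ k ≤ 1 + (x ^ 2) ^ k := by
      rw [← sq_abs, ← pow_mul, mul_comm 2 k, pow_mul]
      nlinarith [sq_nonneg (|x| ^ k - 1), sq_nonneg (|x| ^ k)]
    rw [← div_eq_mul_inv, div_le_iff₀ hW, add_mul]
    refine h3.trans (add_le_add ?_ ?_)
    · rwa [← div_eq_inv_mul, one_le_div (ha 0)]
    · rwa [← div_eq_inv_mul, le_div_iff₀ (ha k), mul_comm]

/-- The bound depends neither on x nor on the coefficients, so the partial sums converge uniformly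
on |x| ≤ R. -/
theorem tail_le (ha : ∀ n, 0 < a n) (ha' : ∀ n, a n ≤ 1 / n.factorial) {R x : ℝ}
    (hx : |x| ≤ R) (N : ℕ) :
    (∑' n, a n * (x ^ 2) ^ n) - ∑ n ∈ Finset.range N, a n * (x ^ 2) ^ n ≤
      ∑' n, (R ^ 2) ^ (n + N) / (n + N).factorial := by
  rw [← (summable_mul_sq_pow ha ha' x).sum_add_tsum_nat_add N, add_sub_cancel_left]
  exact Summable.tsum_le_tsum (fun n => (le_abs_self _).trans (norm_mul_sq_pow_le ha ha' hx _))
    ((summable_nat_add_iff N).2 (summable_mul_sq_pow ha ha' x))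
    ((summable_nat_add_iff N).2 (Real.summable_pow_div_factorial (R ^ 2)))

end Weight

/-! ### Approximating smooth vectors by vectors in the range of g(S) -/

section Approximation

variable {H : Type*} [NormedAddCommGroup H] [InnerProductSpace ℂ H] [CompleteSpace H]
  {S : H →ₗ.[ℂ] H} {D : Submodule ℂ H}

/-- With `g = 1 / ∑ₙ aₙ x²ⁿ`, one has `g(S) ∑_{n < N} aₙ S²ⁿ φ → φ` for `φ ∈ D^∞(S)`. -/
theorem tendsto_funCalcD_invSeries (hS : IsSelfAdjoint S) (hD : D = smoothDomain S) {a : ℕ → ℝ}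
    (ha : ∀ n, 0 < a n) (ha' : ∀ n, a n ≤ 1 / n.factorial) (φ : D) :
    Tendsto (fun N => (funCalcD hS hD (invSeries ha ha')
      (∑ n ∈ Finset.range N, (a n : ℂ) • ((restr S hD ^ (2 * n)) φ : H)) : H)) atTop
      (𝓝 (φ : H)) := by
  set g := invSeries ha ha' with hg
  have hgr := g.rapidlyDecreasing
  have hgx : ∀ x, g.toFun x = (∑' n, a n * (x ^ 2) ^ n)⁻¹ := fun x => rfl
  have hterm : ∀ n, RapidlyDecreasing fun x => (a n : ℂ) * ((x : ℂ) ^ (2 * n) * (g.toFun x : ℂ)) :=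
    fun n => (hgr.ofReal_pow_mul (2 * n)).const_mul _
  set F : ℕ → ℝ → ℂ := fun N x =>
    ∑ n ∈ Finset.range N, (a n : ℂ) * ((x : ℂ) ^ (2 * n) * (g.toFun x : ℂ)) with hF
  -- Since g times the full series is 1, F N - 1 is minus the tail of the series multiplied by g.
  have hFx : ∀ N x, ‖F N x - 1‖ = ((∑' n, a n * (x ^ 2) ^ n) -
      ∑ n ∈ Finset.range N, a n * (x ^ 2) ^ n) * g.toFun x := by
    intro N x
    have h1 : F N x - 1 = ((-(((∑' n, a n * (x ^ 2) ^ n) -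
      ∑ n ∈ Finset.range N, a n * (x ^ 2) ^ n) * g.toFun x) : ℝ) : ℂ) := by
      have hW : (∑' n, a n * (x ^ 2) ^ n) * g.toFun x = 1 :=
        mul_inv_cancel₀ (inv_pos.1 (g.pos x)).ne'
      rw [sub_mul, hW, Finset.sum_mul, hF]
      push_cast
      simp only [pow_mul, mul_assoc]
      ring
    rw [h1, Complex.norm_real, norm_neg, Real.norm_of_nonneg]
    refine mul_nonneg (sub_nonneg.2 ?_) (g.pos x).le
    exact (summable_mul_sq_pow ha ha' x).sum_le_tsum _
      fun m _ => mul_nonneg (ha m).le (by positivity)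
  have key := tendsto_funCalc_apply hS (F := F) (fun N => RapidlyDecreasing.sum hterm N)
    (fun N x => ?_) (fun R ε hε => ?_) ⟨φ, smoothDomain_le S (hD.le φ.2)⟩
  · refine key.congr fun N => ?_
    change _ = funCalc hS (fun x => (g.toFun x : ℂ)) _
    rw [funCalc_sum hS hterm, map_sum, sum_apply]
    refine Finset.sum_congr rfl fun n _ => ?_
    rw [funCalc_const_mul hS (hgr.ofReal_pow_mul (2 * n)), map_smul, funCalc_restr_pow hS hD hgr]
    rfl
  · rw [hFx, hgx, ← div_eq_mul_inv, div_le_one (inv_pos.1 (g.pos x)), sub_le_self_iff]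
    exact Finset.sum_nonneg fun m _ => mul_nonneg (ha m).le (by positivity)
  -- The tail of the exponential series is eventually at most ε a₀, and a₀ is a lower bound for the
  -- full series; after multiplication by g at most ε remains.
  · have htail := tendsto_sum_nat_add fun n : ℕ => (R ^ 2) ^ n / (n.factorial : ℝ)
    filter_upwards [htail.eventually_le_const (mul_pos hε (ha 0))] with N hN x hx
    rw [hFx, hgx, ← div_eq_mul_inv, div_le_iff₀ (inv_pos.1 (g.pos x))]
    refine (tail_le ha ha' hx N).trans (hN.trans ?_)
    exact mul_le_mul_of_nonneg_left (by simpa using mul_sq_pow_le_tsum ha ha' x 0) hε.le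

/-- For every sequence of bounds there is a function `g` such that all vectors of `D^∞(S)`
obeying these bounds are limits of vectors `g(S) z` with `z` in a fixed ball. -/
theorem exists_rapidFun_tendsto (hS : IsSelfAdjoint S) (hD : D = smoothDomain S) {C : ℕ → ℝ}
    (hC : ∀ n, 0 ≤ C n) :
    ∃ (g : RapidFun) (K : ℝ), 0 ≤ K ∧ ∀ (φ : D) (r : ℝ), 0 ≤ r →
      (∀ n, ‖((restr S hD ^ n) φ : H)‖ ≤ C n * r) →
      ∃ z : ℕ → H, (∀ N, ‖z N‖ ≤ K * r) ∧
        Tendsto (fun N => (funCalcD hS hD g (z N) : H)) atTop (𝓝 (φ : H)) := by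
  -- The factor 1 + C(2n) gives aₙ C(2n) ≤ 1/n! and keeps the denominator positive when C(2n) = 0;
  -- the factorial makes ∑ aₙ C(2n) at most e, which is the constant K.
  set a : ℕ → ℝ := fun n => 1 / (n.factorial * (1 + C (2 * n))) with ha_def
  have hpos : ∀ n, 0 < 1 + C (2 * n) := fun n => by linarith [hC (2 * n)]
  have hfac : ∀ n : ℕ, (0 : ℝ) < n.factorial := fun n => by exact_mod_cast n.factorial_pos
  have ha : ∀ n, 0 < a n := fun n => one_div_pos.2 (mul_pos (hfac n) (hpos n))
  have ha' : ∀ n, a n ≤ 1 / n.factorial := fun n =>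
    one_div_le_one_div_of_le (hfac n)
      (le_mul_of_one_le_right (hfac n).le (by linarith [hC (2 * n)]))
  refine ⟨invSeries ha ha', Real.exp 1, (Real.exp_pos 1).le, fun φ r hr hφ =>
    ⟨_, fun N => ?_, tendsto_funCalcD_invSeries hS hD ha ha' φ⟩⟩
  have hsum := Real.sum_le_exp_of_nonneg zero_le_one N
  refine (norm_sum_le _ _).trans ((Finset.sum_le_sum fun n _ => ?_).trans
    ((Finset.sum_mul _ _ _).symm.le.trans (mul_le_mul_of_nonneg_right hsum hr)))
  rw [norm_smul, Complex.norm_real, Real.norm_of_nonneg (ha n).le, one_pow]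
  refine (mul_le_mul_of_nonneg_left (hφ (2 * n)) (ha n).le).trans ?_
  rw [← mul_assoc]
  refine mul_le_mul_of_nonneg_right ?_ hr
  rw [ha_def]
  simp only
  rw [one_div_mul_eq_div, div_le_div_iff₀ (mul_pos (hfac n) (hpos n)) (hfac n), one_mul, mul_comm]
  exact mul_le_mul_of_nonneg_left (by linarith) (hfac n).le

end Approximation

/-! ### Comparison of seminorm topologies, and the adjoint in L†(D) -/

theorem withSeminorms_seminormTopology {E ι : Type*} [AddCommGroup E] [Module ℂ E]
    (p : ι → Seminorm ℂ E) : @WithSeminorms ℂ E ι _ _ _ p (seminormTopology p) := by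
  let _ : TopologicalSpace E := seminormTopology p
  have : IsTopologicalAddGroup E := topologicalAddGroup_iInf fun i =>
    (p i).toSeminormedAddCommGroup.toIsTopologicalAddGroup
  exact (SeminormFamily.withSeminorms_iff_topologicalSpace_eq_iInf p).2 rfl

theorem seminormTopology_le {E ι κ : Type*} [AddCommGroup E] [Module ℂ E]
    {p : ι → Seminorm ℂ E} {q : κ → Seminorm ℂ E}
    (h : ∀ i, ∃ (s : Finset ι) (C : ℝ), 0 ≤ C ∧ ∀ x, q i x ≤ C * ∑ j ∈ s, p j x) :
    seminormTopology p ≤ seminormTopology q := by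
  rw [← continuous_id_iff_le]
  refine (withSeminorms_seminormTopology p).continuous_of_isBounded
    (withSeminorms_seminormTopology q) LinearMap.id (Seminorm.IsBounded.of_real fun i => ?_)
  obtain ⟨s, C, hC, hs⟩ := h i
  -- The boundedness criterion uses the supremum of the seminorms, and a sum is at most the number
  -- of terms times the supremum.
  refine ⟨s, C * s.card, fun x => (hs x).trans ?_⟩
  rw [mul_assoc]
  refine mul_le_mul_of_nonneg_left ?_ hC
  rw [← nsmul_eq_mul]
  exact Finset.sum_le_card_nsmul _ _ _ fun j hj => Seminorm.le_finset_sup_apply hj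

theorem exists_dagger {H : Type*} [NormedAddCommGroup H] [InnerProductSpace ℂ H]
    {D : Submodule ℂ H} (A : LDagger D) : ∃ B : LDagger D,
    ∀ ψ φ : D, ⟪(B.1 ψ : H), (φ : H)⟫_ℂ = ⟪(ψ : H), (A.1 φ : H)⟫_ℂ := by
  obtain ⟨B, hB⟩ := continuous_weak_iff_exists.1 A.2
  exact ⟨⟨B, continuous_weak_iff_exists.2 ⟨A.1, fun ψ φ => by
    rw [← inner_conj_symm, ← hB, inner_conj_symm]⟩⟩, hB⟩

/-! ### Transfer of estimates between two self-adjoint operators -/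

section Comparison

variable {H : Type*} [NormedAddCommGroup H] [InnerProductSpace ℂ H] [CompleteSpace H]
  {S T : H →ₗ.[ℂ] H} {D : Submodule ℂ H}

theorem inner_restr_pow (hS : IsSelfAdjoint S) (hD : D = smoothDomain S) (k : ℕ) (ψ φ : D) :
    ⟪((restr S hD ^ k) ψ : H), (φ : H)⟫_ℂ = ⟪(ψ : H), ((restr S hD ^ k) φ : H)⟫_ℂ := by
  induction k generalizing ψ φ with
  | zero => rfl
  | succ k ih =>
    rw [pow_succ, Module.End.mul_apply, ih, ← pow_succ, pow_succ', Module.End.mul_apply,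
      coe_restr_apply, coe_restr_apply]
    exact inner_symm_of_isSelfAdjoint hS ⟨ψ, _⟩ ⟨_, _⟩

/-- `‖f(S) A Sᵏ‖ = ‖Sᵏ A† f(S)‖`. -/
theorem norm_rightMap (hS : IsSelfAdjoint S) (hD : D = smoothDomain S) (f : RapidFun) (k : ℕ)
    {A B : LDagger D} (hB : ∀ ψ φ : D, ⟪(B.1 ψ : H), (φ : H)⟫_ℂ = ⟪(ψ : H), (A.1 φ : H)⟫_ℂ) :
    ‖rightMap hS hD f k A‖ = ‖leftMap hS hD f k B‖ := by
  have hdense : Dense (D : Set H) := hD ▸ dense_smoothDomain hS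
  -- f(S) A Sᵏ is the restriction to D of the adjoint of the bounded operator Sᵏ A† f(S); as D is
  -- dense, restriction does not change the norm.
  have key : ∀ φ : D, rightMap hS hD f k A φ =
      ContinuousLinearMap.adjoint (leftMap hS hD f k B) (φ : H) := by
    intro φ
    refine ext_inner_left ℂ fun v => ?_
    rw [ContinuousLinearMap.adjoint_inner_right, leftMap_apply, inner_restr_pow hS, hB,
      ← inner_funCalcD hS]
    rfl
  rw [← (ContinuousLinearMap.adjoint (𝕜 := ℂ) (E := H) (F := H)).norm_map
    (leftMap hS hD f k B)]
  refine le_antisymm (ContinuousLinearMap.opNorm_le_bound _ (norm_nonneg _) fun φ => ?_)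
    (ContinuousLinearMap.opNorm_le_bound _ (ContinuousLinearMap.opNorm_nonneg _) fun x => ?_)
  · rw [key]
    exact ContinuousLinearMap.le_opNorm _ _
  · refine hdense.induction (P := fun x =>
      ‖ContinuousLinearMap.adjoint (leftMap hS hD f k B) x‖ ≤ ‖rightMap hS hD f k A‖ * ‖x‖)
      (fun x hx => ?_) (isClosed_le (by fun_prop) (by fun_prop)) x
    rw [← key ⟨x, hx⟩]
    exact (rightMap hS hD f k A).le_opNorm ⟨x, hx⟩

/-- The heart of (2). Automatic continuity replaces Tᵏ on the left by powers of S, and absorption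
replaces f(T) on the right by g(S). Both g and the finite set of exponents are independent of A. -/
theorem exists_norm_leftMap_le (hS : IsSelfAdjoint S) (hDS : D = smoothDomain S)
    (hT : IsSelfAdjoint T) (hDT : D = smoothDomain T) (f : RapidFun) (k : ℕ) :
    ∃ (g : RapidFun) (s : Finset ℕ) (C : ℝ), 0 ≤ C ∧ ∀ A : LDagger D,
      ‖leftMap hT hDT f k A‖ ≤ C * ∑ j ∈ s, ‖leftMap hS hDS g j A‖ := by
  have hdense : Dense (D : Set H) := hDS ▸ dense_smoothDomain hS
  have hSpow := fun n => pow_mem_LDagger (restr_mem_LDagger hS hDS) n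
  obtain ⟨s, C, hC, hs⟩ := exists_norm_apply_le_sum hS hDS
    (pow_mem_LDagger (restr_mem_LDagger hT hDT) k)
  -- The operators Sⁿ f(T), bounded because Sⁿ belongs to L†(D); their norms are the growth bounds
  -- to which g is adapted.
  let W : ℕ → H →L[ℂ] H := fun n =>
    ⟨D.subtype ∘ₗ (restr S hDS ^ n) ∘ₗ funCalcD hT hDT f,
      continuous_comp_funCalcD hT hDT (hSpow n) f⟩
  obtain ⟨g, K, hK, hg⟩ := exists_rapidFun_tendsto hS hDS fun n => norm_nonneg (W n)
  refine ⟨g, s, C * K, mul_nonneg hC hK, fun A => ContinuousLinearMap.opNorm_le_bound _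
    (mul_nonneg (mul_nonneg hC hK) (Finset.sum_nonneg fun _ _ => norm_nonneg _)) fun y => ?_⟩
  obtain ⟨z, hz, hlim⟩ := hg (funCalcD hT hDT f y) ‖y‖ (norm_nonneg y) fun n => (W n).le_opNorm y
  -- Lower semicontinuity is applied to Sʲ A along g(S) z_N → f(T) y, where Sʲ A g(S) is bounded and
  -- ‖z_N‖ ≤ K‖y‖.
  have hj : ∀ j, ‖((restr S hDS ^ j) (A.1 (funCalcD hT hDT f y)) : H)‖ ≤
      ‖leftMap hS hDS g j A‖ * (K * ‖y‖) := fun j =>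
    norm_apply_le_of_tendsto hdense (mul_mem_LDagger (hSpow j) A.2) hlim fun N =>
      ((leftMap hS hDS g j A).le_opNorm (z N)).trans
        (mul_le_mul_of_nonneg_left (hz N) (norm_nonneg _))
  rw [leftMap_apply]
  calc _ ≤ C * ∑ j ∈ s, ‖((restr S hDS ^ j) (A.1 (funCalcD hT hDT f y)) : H)‖ := hs _
    _ ≤ C * ∑ j ∈ s, ‖leftMap hS hDS g j A‖ * (K * ‖y‖) := by gcongr with j _; exact hj j
    _ = _ := by rw [← Finset.sum_mul]; ring

theorem graphTopology_le (hS : IsSelfAdjoint S) (hDS : D = smoothDomain S)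
    (hT : IsSelfAdjoint T) (hDT : D = smoothDomain T) :
    graphTopology S hDS ≤ graphTopology T hDT :=
  seminormTopology_le fun k =>
    exists_norm_apply_le_sum hS hDS (pow_mem_LDagger (restr_mem_LDagger hT hDT) k)

/-- One estimate serves both halves of the seminorm: applied to A it bounds Tᵏ A f(T), and applied
to A† it bounds f(T) A Tᵏ, since the adjoint interchanges the two halves. -/
theorem quasiUniformTopology_le (hS : IsSelfAdjoint S) (hDS : D = smoothDomain S)
    (hT : IsSelfAdjoint T) (hDT : D = smoothDomain T) :
    quasiUniformTopology hS hDS ≤ quasiUniformTopology hT hDT := by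
  refine seminormTopology_le fun ⟨f, k⟩ => ?_
  obtain ⟨g, s, C, hC, hs⟩ := exists_norm_leftMap_le hS hDS hT hDT f k
  refine ⟨s.map ⟨Prod.mk g, Prod.mk_right_injective g⟩, C, hC, fun A => ?_⟩
  rw [Finset.sum_map, quasiUniformSeminorm_apply]
  obtain ⟨B, hB⟩ := exists_dagger A
  refine max_le ((hs A).trans ?_) ?_
  · gcongr with j _
    exact le_max_left _ _
  · rw [norm_rightMap hT hDT f k hB]
    refine (hs B).trans ?_
    gcongr with j _
    rw [← norm_rightMap hS hDS g j hB]
    exact le_max_right _ _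

end Comparison

end QuasiUniform

theorem mainTheorem11 {H : Type*} [NormedAddCommGroup H] [InnerProductSpace ℂ H] [CompleteSpace H]
    (H₀ B : H →ₗ.[ℂ] H) (D : Submodule ℂ H)
    (hH₀ : IsSelfAdjoint H₀)
    (hB : H₀.domain ≤ B.domain)
    (hH : IsSelfAdjoint (H₀ + B))
    (hD₀ : D = QuasiUniform.smoothDomain H₀)
    (hD : D = QuasiUniform.smoothDomain (H₀ + B)) :
    QuasiUniform.graphTopology H₀ hD₀ = QuasiUniform.graphTopology (H₀ + B) hD ∧
    QuasiUniform.quasiUniformTopology hH₀ hD₀ = QuasiUniform.quasiUniformTopology hH hD :=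
  ⟨le_antisymm (QuasiUniform.graphTopology_le hH₀ hD₀ hH hD)
      (QuasiUniform.graphTopology_le hH hD hH₀ hD₀),
    le_antisymm (QuasiUniform.quasiUniformTopology_le hH₀ hD₀ hH hD)
      (QuasiUniform.quasiUniformTopology_le hH hD hH₀ hD₀)⟩
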